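/- **Vectors and Gray map.** For a vector $\mathbf u\in\mathbb Z_2^{\alpha_1}\times\mathbb Z_4^{\alpha_2}\times\mathbb Z_8^{\alpha_3}$, let $o(\mathbf u)$ be its order, the least $m\ge 1$ with $m\mathbf u=\mathbf 0$. Write $u\in\mathbb Z_{2^s}$ in binary as $u=\sum_{i=0}^{s-1}u_i2^i$ with $u_i\in\{0,1\}$. Carlet's Gray map $\phi_s:\mathbb Z_{2^s}\to\mathbb Z_2^{2^{s-1}}$ is $$\phi_s(u)=(u_{s-1},\dots,u_{s-1})+(u_0,\dots,u_{s-2})\,Y_{s-1},$$ where $Y_{s-1}$ is the $(s-1)\times 2^{s-1}$ binary matrix whose $j$-th column ($0\le j<2^{s-1}$) is the binary expansion $(j_0,\dots,j_{s-2})^T$ of $j=\sum_i j_i2^i$. Put $$\Phi(u_1\mid u_2\mid u_3)=(u_1,\Phi_2(u_2),\Phi_3(u_3))\in\mathbb Z_2^n,\qquad n=\alpha_1+2\alpha_2+4\alpha_3,$$ where $\Phi_s$ applies $\phi_s$ to each coordinate. **The matrices.** For integers $t_1\ge1$, $t_2\ge0$, $t_3\ge1$, a matrix $A^{t_1,t_2,t_3}=(A_1\mid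 A_2\mid A_3)$ with $t_1+t_2+t_3$ rows, and with blocks over $\mathbb Z_2$, $\mathbb Z_4$, $\mathbb Z_8$, is defined as follows. Bold numerals denote constant vectors. * Start from $$A^{1,0,1}=\left(\begin{array}{cc|c|c}1&1&2&4\\0&1&1&1\end{array}\right).$$ * For $\ell=2,\dots,t_1$, with $A^{\ell-1,0,1}=(A_1\mid A_2\mid A_3)$, $$A^{\ell,0,1}=\left(\begin{array}{cc|ccccc|ccccc}A_1&A_1&M_1&A_2&A_2&A_2&A_2&M_2&A_3&A_3&\cdots&A_3\\ \mathbf0&\mathbf1&\mathbf1&\mathbf0&\mathbf1&\mathbf2&\mathbf3&\mathbf1&\mathbf0&\mathbf1&\cdots&\mathbf7\end{array}\right),$$ where the columns of $M_1$ are all vectors of $\{2\}\times\{0,2\}^{\ell-1}$ and those of $M_2$ are all vectors of $\{4\}\times\{0,2,4,6\}^{\ell-1}$. * For $\ell=1,\dots,t_2$, with $A^{t_1,\ell-1,1}=(A_1\mid A_2\mid A_3)$, $$A^{t_1,\ell,1}=\left(\begin{array}{cc|ccccc|cccc}A_1&A_1&M_1&A_2&A_2&A_2&A_2&A_3&A_3&A_3&A_3\\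 \mathbf0&\mathbf1&\mathbf1&\mathbf0&\mathbf1&\mathbf2&\mathbf3&\mathbf0&\mathbf2&\mathbf4&\mathbf6\end{array}\right),$$ where the columns of $M_1$ are all vectors of $\{2\}\times\{0,2\}^{t_1+\ell-1}$. * For $\ell=2,\dots,t_3$, with $A^{t_1,t_2,\ell-1}=(A_1\mid A_2\mid A_3)$, $$A^{t_1,t_2,\ell}=\left(\begin{array}{cc|cc|cc}A_1&A_1&A_2&A_2&A_3&A_3\\ \mathbf0&\mathbf1&\mathbf0&\mathbf2&\mathbf0&\mathbf4\end{array}\right).$$ **The codes.** Let $\mathcal H=\mathcal H^{t_1,t_2,t_3}$ be the subgroup of $\mathbb Z_2^{\alpha_1}\times\mathbb Z_4^{\alpha_2}\times\mathbb Z_8^{\alpha_3}$ generated by the rows of $A^{t_1,t_2,t_3}$. A binary code $C\subseteq\mathbb Z_2^n$ is linear if it is a subspace of $\mathbb Z_2^n$. Its kernel is $\mathrm K(C)=\{x\in\mathbb Z_2^n: x+C=C\}$, which is a subspace, and $\ker(C)=\dim_{\mathbb Z_2}\mathrm K(C)$. **Corollary.** Let $t_1\ge1$, $t_2\ge0$,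 $t_3\ge1$ be integers such that $\Phi(\mathcal H^{t_1,t_2,t_3})$ is not linear, and let $\mathbf w_k$ be the $k$-th row of $A^{t_1,t_2,t_3}$. Then the vectors $$\Phi\Big(\tfrac{o(\mathbf w_k)}{2}\,\mathbf w_k\Big),\qquad k=1,\dots,t_1+t_2+t_3,$$ form a basis of $\mathrm K(\Phi(\mathcal H^{t_1,t_2,t_3}))$ over $\mathbb Z_2$, and $\ker(\Phi(\mathcal H^{t_1,t_2,t_3}))=t_1+t_2+t_3$. -/

import Mathlib

namespace Z2Z4Z8

/-! ## Vectors over the mixed alphabet and the Gray map -/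

/-- The group `ℤ₂^α₁ × ℤ₄^α₂ × ℤ₈^α₃`; the three blocks of coordinates are indexed by
`ι₁`, `ι₂`, `ι₃`, with `α₁`, `α₂`, `α₃` elements respectively. -/
abbrev MixedSpace (ι₁ ι₂ ι₃ : Type) : Type :=
  (ι₁ → ZMod 2) × (ι₂ → ZMod 4) × (ι₃ → ZMod 8)

/-- The coordinates of the binary space `ℤ₂^n`, `n = α₁ + 2 α₂ + 4 α₃`. -/
abbrev GrayIndex (ι₁ ι₂ ι₃ : Type) : Type :=
  ι₁ ⊕ ((ι₂ × Fin 2) ⊕ (ι₃ × Fin 4))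

/-- The `i`-th digit of the binary expansion of `u`, as an element of `ℤ₂`. -/
def binDigit (u i : ℕ) : ZMod 2 := ((u / 2 ^ i % 2 : ℕ) : ZMod 2)

/-- Carlet's Gray map
`φ_s(u) = (u_{s-1}, …, u_{s-1}) + (u_0, …, u_{s-2}) Y_{s-1}`, where column `j` of `Y_{s-1}`
is the binary expansion of `j`. -/
def carletGray (s : ℕ) (u : ZMod (2 ^ s)) : Fin (2 ^ (s - 1)) → ZMod 2 := fun j =>
  binDigit u.val (s - 1) + ∑ i ∈ Finset.range (s - 1), binDigit u.val i * binDigit j i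

/-- `φ₂ : ℤ₄ → ℤ₂²`. -/
def gray₂ (u : ZMod 4) : Fin 2 → ZMod 2 := carletGray 2 u

/-- `φ₃ : ℤ₈ → ℤ₂⁴`. -/
def gray₃ (u : ZMod 8) : Fin 4 → ZMod 2 := carletGray 3 u

/-- The Gray map `Φ(u₁ ∣ u₂ ∣ u₃) = (u₁, Φ₂(u₂), Φ₃(u₃))`. -/
def grayMap {ι₁ ι₂ ι₃ : Type} (u : MixedSpace ι₁ ι₂ ι₃) : GrayIndex ι₁ ι₂ ι₃ → ZMod 2 :=
  Sum.elim u.1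
    (Sum.elim (fun p => gray₂ (u.2.1 p.1) p.2) (fun p => gray₃ (u.2.2 p.1) p.2))

/-! ## Binary codes -/

/-- A binary code is linear if it is a subspace. -/
def IsLinearCode {ι : Type} (C : Set (ι → ZMod 2)) : Prop :=
  ∃ S : Submodule (ZMod 2) (ι → ZMod 2), (S : Set (ι → ZMod 2)) = C

/-- The kernel `K(C) = {x : x + C = C}` of a binary code, which is a subspace. -/
def codeKernel {ι : Type} (C : Set (ι → ZMod 2)) : Submodule (ZMod 2) (ι → ZMod 2) where
  carrier := {x | (fun c => x + c) '' C = C}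
  zero_mem' := by simp
  add_mem' := by
    intro x y hx hy
    have hx' : (fun c => x + c) '' C = C := hx
    have hy' : (fun c => y + c) '' C = C := hy
    change (fun c => (x + y) + c) '' C = C
    have h : (fun c => (x + y) + c) = (fun c => x + c) ∘ (fun c => y + c) := by
      funext c
      simp [add_assoc]
    rw [h, Set.image_comp, hy', hx']
  smul_mem' := by
    intro a x hx
    have hx' : (fun c => x + c) '' C = C := hx
    change (fun c => a • x + c) '' C = C
    have ha : a = 0 ∨ a = 1 := by
      revert a
      decide
    rcases ha with rfl | rfl
    · simp
    · simpa using hx'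

/-- `ker(C)`, the dimension of the kernel. -/
noncomputable def kerDim {ι : Type} (C : Set (ι → ZMod 2)) : ℕ :=
  Module.finrank (ZMod 2) (codeKernel C)

/-! ## The matrices `A^{t₁,t₂,t₃}` -/

/-- A matrix `(A₁ ∣ A₂ ∣ A₃)` with `r` rows and with finitely many columns over `ℤ₂`, over `ℤ₄`
and over `ℤ₈`. -/
structure MixedMatrix (r : ℕ) where
  ι₁ : Type
  ι₂ : Type
  ι₃ : Type
  [fintype₁ : Fintype ι₁]
  [fintype₂ : Fintype ι₂]
  [fintype₃ : Fintype ι₃]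
  A₁ : Matrix (Fin r) ι₁ (ZMod 2)
  A₂ : Matrix (Fin r) ι₂ (ZMod 4)
  A₃ : Matrix (Fin r) ι₃ (ZMod 8)

attribute [instance] MixedMatrix.fintype₁ MixedMatrix.fintype₂ MixedMatrix.fintype₃

namespace MixedMatrix

/-- The `k`-th row, as a vector over the mixed alphabet. -/
def row {r : ℕ} (M : MixedMatrix r) (k : Fin r) : MixedSpace M.ι₁ M.ι₂ M.ι₃ :=
  (M.A₁ k, M.A₂ k, M.A₃ k)

/-- The additive code generated by the rows. -/
def additiveCode {r : ℕ} (M : MixedMatrix r) : AddSubgroup (MixedSpace M.ι₁ M.ι₂ M.ι₃) :=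
  AddSubgroup.closure (Set.range M.row)

/-- The binary code `Φ(𝒞)`, where `𝒞` is the additive code generated by the rows. -/
def binaryCode {r : ℕ} (M : MixedMatrix r) : Set (GrayIndex M.ι₁ M.ι₂ M.ι₃ → ZMod 2) :=
  grayMap '' (M.additiveCode : Set (MixedSpace M.ι₁ M.ι₂ M.ι₃))

/-- The same matrix, with its number of rows written differently. -/
def castRows {r r' : ℕ} (h : r = r') (M : MixedMatrix r) : MixedMatrix r' where
  ι₁ := M.ι₁
  ι₂ := M.ι₂
  ι₃ := M.ι₃
  A₁ := M.A₁.submatrix (Fin.cast h.symm) id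
  A₂ := M.A₂.submatrix (Fin.cast h.symm) id
  A₃ := M.A₃.submatrix (Fin.cast h.symm) id

end MixedMatrix

/-- The matrix whose first rows are `(B B ⋯ B)`, with `m` copies of `B`, and whose new last row is
`(0·a, 1·a, …, (m-1)·a)`, each entry repeated along its copy of `B`. -/
def copies {r n : ℕ} {ι : Type} (m : ℕ) (a : ZMod n) (B : Matrix (Fin r) ι (ZMod n)) :
    Matrix (Fin (r + 1)) (Fin m × ι) (ZMod n) :=
  Matrix.of fun i p => Fin.snoc (α := fun _ => ZMod n) (fun k => B k p.2) (a * (p.1 : ℕ)) i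

/-- The matrix whose columns are all the vectors of
`{a} × {0, 2, …, 2(m-1)}^s × {1}`. -/
def evenBlock (s n m : ℕ) (a : ZMod n) : Matrix (Fin (s + 2)) (Fin s → Fin m) (ZMod n) :=
  Matrix.of fun i z => Fin.snoc (α := fun _ => ZMod n)
    (Fin.cons (α := fun _ => ZMod n) a (fun k : Fin s => 2 * ((z k : ℕ) : ZMod n))) 1 i

/-- The matrix `A^{1,0,1}`, with rows `(1 1 ∣ 2 ∣ 4)` and `(0 1 ∣ 1 ∣ 1)`. -/
def baseMatrix : MixedMatrix 2 where
  ι₁ := Fin 2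
  ι₂ := Fin 1
  ι₃ := Fin 1
  A₁ := !![1, 1; 0, 1]
  A₂ := !![2; 1]
  A₃ := !![4; 1]

/-- Adding a row of order 8:
`(A₁ A₁ ∣ M₁ A₂ A₂ A₂ A₂ ∣ M₂ A₃ A₃ ⋯ A₃)` over `(0 1 ∣ 1 0 1 2 3 ∣ 1 0 1 ⋯ 7)`, where the columns
of `M₁` are `{2} × {0,2}^s` and those of `M₂` are `{4} × {0,2,4,6}^s`. -/
def addRow8 {s : ℕ} (M : MixedMatrix (s + 1)) : MixedMatrix (s + 2) where
  ι₁ := Fin 2 × M.ι₁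
  ι₂ := (Fin s → Fin 2) ⊕ (Fin 4 × M.ι₂)
  ι₃ := (Fin s → Fin 4) ⊕ (Fin 8 × M.ι₃)
  A₁ := copies 2 1 M.A₁
  A₂ := Matrix.fromCols (evenBlock s 4 2 2) (copies 4 1 M.A₂)
  A₃ := Matrix.fromCols (evenBlock s 8 4 4) (copies 8 1 M.A₃)

/-- Adding a row of order 4:
`(A₁ A₁ ∣ M₁ A₂ A₂ A₂ A₂ ∣ A₃ A₃ A₃ A₃)` over `(0 1 ∣ 1 0 1 2 3 ∣ 0 2 4 6)`, where the columns
of `M₁` are `{2} × {0,2}^s`. -/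
def addRow4 {s : ℕ} (M : MixedMatrix (s + 1)) : MixedMatrix (s + 2) where
  ι₁ := Fin 2 × M.ι₁
  ι₂ := (Fin s → Fin 2) ⊕ (Fin 4 × M.ι₂)
  ι₃ := Fin 4 × M.ι₃
  A₁ := copies 2 1 M.A₁
  A₂ := Matrix.fromCols (evenBlock s 4 2 2) (copies 4 1 M.A₂)
  A₃ := copies 4 2 M.A₃

/-- Adding a row of order 2: `(A₁ A₁ ∣ A₂ A₂ ∣ A₃ A₃)` over `(0 1 ∣ 0 2 ∣ 0 4)`. -/
def addRow2 {r : ℕ} (M : MixedMatrix r) : MixedMatrix (r + 1) where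
  ι₁ := Fin 2 × M.ι₁
  ι₂ := Fin 2 × M.ι₂
  ι₃ := Fin 2 × M.ι₃
  A₁ := copies 2 1 M.A₁
  A₂ := copies 2 2 M.A₂
  A₃ := copies 2 4 M.A₃

/-- `A^{a+1,0,1}`. -/
def matrixA8 : (a : ℕ) → MixedMatrix (a + 1 + 1)
  | 0 => baseMatrix
  | a + 1 => addRow8 (matrixA8 a)

/-- `A^{a+1,b,1}`. -/
def matrixA84 (a : ℕ) : (b : ℕ) → MixedMatrix (a + 1 + b + 1)
  | 0 => matrixA8 a
  | b + 1 => addRow4 (matrixA84 a b)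

/-- `A^{a+1,b,c+1}`. -/
def matrixA842 (a b : ℕ) : (c : ℕ) → MixedMatrix (a + 1 + b + 1 + c)
  | 0 => matrixA84 a b
  | c + 1 => addRow2 (matrixA842 a b c)

/-- The matrix `A^{t₁,t₂,t₃}`, for `t₁ ≥ 1`, `t₂ ≥ 0`, `t₃ ≥ 1`, with `t₁ + t₂ + t₃` rows. -/
def matrixA (t₁ t₂ t₃ : ℕ) (h₁ : 1 ≤ t₁) (h₃ : 1 ≤ t₃) : MixedMatrix (t₁ + t₂ + t₃) :=
  (matrixA842 (t₁ - 1) t₂ (t₃ - 1)).castRows (by omega)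

end Z2Z4Z8

/-!
Write a vector over the mixed alphabet through the binary digits of its coordinates. Carlet's Gray
map is linear in the digits and injective, so `Φ(u) + Φ(v) = Φ(u ⊕ v)`, where `⊕` adds digits modulo
2; since `u ⊕ v = u + v - 2 (u & v)`, the kernel of `Φ(H)` consists of those `Φ(h)`, `h ∈ H`, for
which the carry `2 (h & g)` lies in `H` for all `g ∈ H` (`mem_codeKernel_grayMap_iff`). If `2h = 0`
all these carries vanish, and `Φ` is linear on the vectors of order at most two; so `Φ` embeds the
2-torsion of `H` into the kernel. The rows `w_k` generate `H` with no relations but their orders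
(`sum_zsmul_row_eq_zero_iff`), hence the vectors `(o(w_k)/2) w_k` form a basis of the 2-torsion.

It remains to see that `2h = 0` is necessary when `Φ(H)` is not linear. The columns of the matrix
are vectors `(1, x)` over `ℤ₂`, `(2, x)` over `ℤ₄` and `(4, x)` over `ℤ₈`, written below as `x`, and
a codeword is an affine form evaluated at them; a carry vanishes on the coordinates over `ℤ₂`, so if
it is a codeword `∑ b_k w_k`, all its coefficients are even (`two_dvd_of_fst_eq_zero`). Let
`h = ∑ a_k w_k`, and suppose that at least two rows have order greater than two; let `w_i`, `w_j` be two
of them.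

* Over `ℤ₄` the carry of `h` with `w_j` is twice the product of two linear forms modulo 2. Comparing
  the columns `e_i`, `e_j` and `e_i + e_j` shows that it can be linear only if `a_i` is even
  (`two_dvd_of_carry_mem`).
* If `w_i` has order 8 and `a_i ≡ 2` modulo 4, the carry of `h` with `w_j` is `0` at the column
  `e_i` over `ℤ₈` and `4` at `e_i + 2 e_j`, while every `∑ b_k w_k` which this carry could be takes
  the same value at both (`four_dvd_of_carry_mem`).

So `2h = 0`. If, on the other hand, only one row has order greater than two, that is
`t₁ = 1` and `t₂ = 0`, then all carries are multiples of this row and `Φ(H)` is linear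
(`isLinearCode_of_add_eq_one`).
-/

namespace Z2Z4Z8

open MixedMatrix

/-! ### Carries and the kernel of a Gray image -/

theorem gray₂_add : ∀ u v : ZMod 4,
    gray₂ u + gray₂ v = gray₂ (u + v - 2 * ((u.val &&& v.val : ℕ) : ZMod 4)) := by
  decide +kernel

theorem gray₃_add : ∀ u v : ZMod 8,
    gray₃ u + gray₃ v = gray₃ (u + v - 2 * ((u.val &&& v.val : ℕ) : ZMod 8)) := by
  decide +kernel

theorem gray₂_injective : Function.Injective gray₂ := by
  have : ∀ u v, gray₂ u = gray₂ v → u = v := by decide +kernel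
  exact fun u v => this u v

theorem gray₃_injective : Function.Injective gray₃ := by
  have : ∀ u v, gray₃ u = gray₃ v → u = v := by decide +kernel
  exact fun u v => this u v

section Carry

variable {ι₁ ι₂ ι₃ : Type}

/-- The carry `2 (u & v)` of the sum `u + v`, where `&` is the bitwise conjunction of the binary
expansions, coordinate by coordinate; in a coordinate over `ℤ₂` the carry vanishes. -/
def carry (u v : MixedSpace ι₁ ι₂ ι₃) : MixedSpace ι₁ ι₂ ι₃ :=
  (0, fun p => 2 * (((u.2.1 p).val &&& (v.2.1 p).val : ℕ) : ZMod 4),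
    fun p => 2 * (((u.2.2 p).val &&& (v.2.2 p).val : ℕ) : ZMod 8))

theorem grayMap_injective :
    Function.Injective (grayMap : MixedSpace ι₁ ι₂ ι₃ → GrayIndex ι₁ ι₂ ι₃ → ZMod 2) := by
  intro u v h
  refine Prod.ext (funext fun p => congrFun h (Sum.inl p)) (Prod.ext (funext fun p => ?_)
    (funext fun p => ?_))
  · exact gray₂_injective (funext fun j => congrFun h (Sum.inr (Sum.inl (p, j))))
  · exact gray₃_injective (funext fun j => congrFun h (Sum.inr (Sum.inr (p, j))))

/-- The Gray map is additive in the binary digits, so the sum of two images is the image of the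
sum without carries. -/
theorem grayMap_add_grayMap (u v : MixedSpace ι₁ ι₂ ι₃) :
    grayMap u + grayMap v = grayMap (u + v - carry u v) := by
  funext q
  rcases q with p | ⟨p, j⟩ | ⟨p, j⟩
  · simp [grayMap, carry]
  · exact congrFun (gray₂_add (u.2.1 p) (v.2.1 p)) j
  · exact congrFun (gray₃_add (u.2.2 p) (v.2.2 p)) j

theorem grayMap_zero : grayMap (0 : MixedSpace ι₁ ι₂ ι₃) = 0 := by
  have h := grayMap_add_grayMap (0 : MixedSpace ι₁ ι₂ ι₃) 0
  have h0 : (0 : MixedSpace ι₁ ι₂ ι₃) + 0 - carry 0 0 = 0 := by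
    refine Prod.ext ?_ (Prod.ext ?_ ?_) <;> funext p <;> simp [carry]
  rw [h0] at h
  simpa using h

theorem carry_eq_zero {u : MixedSpace ι₁ ι₂ ι₃} (hu : 2 • u = 0) (v : MixedSpace ι₁ ι₂ ι₃) :
    carry u v = 0 := by
  have h4 : ∀ x y : ZMod 4, 2 • x = 0 → 2 * ((x.val &&& y.val : ℕ) : ZMod 4) = 0 := by
    decide +kernel
  have h8 : ∀ x y : ZMod 8, 2 • x = 0 → 2 * ((x.val &&& y.val : ℕ) : ZMod 8) = 0 := by
    decide +kernel
  refine Prod.ext rfl (Prod.ext (funext fun p => ?_) (funext fun p => ?_))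
  · exact h4 _ _ (congrFun (congrArg (fun w => w.2.1) hu) p)
  · exact h8 _ _ (congrFun (congrArg (fun w => w.2.2) hu) p)

theorem grayMap_add_of_two_nsmul_eq_zero {u : MixedSpace ι₁ ι₂ ι₃} (hu : 2 • u = 0)
    (v : MixedSpace ι₁ ι₂ ι₃) : grayMap (u + v) = grayMap u + grayMap v := by
  rw [grayMap_add_grayMap, carry_eq_zero hu, sub_zero]

theorem grayMap_val_nsmul {u : MixedSpace ι₁ ι₂ ι₃} (c : ZMod 2) :
    grayMap (c.val • u) = c • grayMap u := by
  have hc : c = 0 ∨ c = 1 := by revert c; decide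
  rcases hc with rfl | rfl
  · simp [grayMap_zero]
  · simp [ZMod.val_one]

/-- On vectors of order at most two the Gray map is linear. -/
theorem grayMap_sum_val_nsmul {κ : Type} (S : Finset κ) (u : κ → MixedSpace ι₁ ι₂ ι₃)
    (hu : ∀ k, 2 • u k = 0) (c : κ → ZMod 2) :
    grayMap (∑ k ∈ S, (c k).val • u k) = ∑ k ∈ S, c k • grayMap (u k) := by
  classical
  induction S using Finset.induction_on with
  | empty => simp [grayMap_zero]
  | insert k S hk ih =>
    rw [Finset.sum_insert hk, Finset.sum_insert hk, grayMap_add_of_two_nsmul_eq_zero, ih,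
      grayMap_val_nsmul]
    rw [smul_comm, hu, smul_zero]

theorem mem_codeKernel_grayMap_iff (H : AddSubgroup (MixedSpace ι₁ ι₂ ι₃))
    (x : GrayIndex ι₁ ι₂ ι₃ → ZMod 2) :
    x ∈ codeKernel (grayMap '' (H : Set (MixedSpace ι₁ ι₂ ι₃))) ↔
      ∃ h ∈ H, grayMap h = x ∧ ∀ g ∈ H, carry h g ∈ H := by
  have hself : ∀ y : GrayIndex ι₁ ι₂ ι₃ → ZMod 2, y + y = 0 := fun y =>
    funext fun q => CharTwo.add_self_eq_zero (y q)
  constructor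
  · intro hx
    have hx : (fun c => x + c) '' (grayMap '' (H : Set (MixedSpace ι₁ ι₂ ι₃))) =
      grayMap '' (H : Set (MixedSpace ι₁ ι₂ ι₃)) := hx
    have hmem : ∀ g ∈ H, x + grayMap g ∈ grayMap '' (H : Set (MixedSpace ι₁ ι₂ ι₃)) :=
      fun g hg => hx ▸ ⟨_, ⟨g, hg, rfl⟩, rfl⟩
    obtain ⟨h, hh, rfl⟩ : x ∈ grayMap '' (H : Set (MixedSpace ι₁ ι₂ ι₃)) := by
      simpa [grayMap_zero] using hmem 0 H.zero_mem
    refine ⟨h, hh, rfl, fun g hg => ?_⟩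
    obtain ⟨w, hw, hwe⟩ := hmem g hg
    rw [grayMap_add_grayMap] at hwe
    have := grayMap_injective hwe
    have hc : carry h g = h + g - w := by rw [this]; abel
    rw [hc]
    exact H.sub_mem (H.add_mem hh hg) hw
  · rintro ⟨h, hh, rfl, hc⟩
    have hsub : ∀ y ∈ grayMap '' (H : Set (MixedSpace ι₁ ι₂ ι₃)),
        grayMap h + y ∈ grayMap '' (H : Set (MixedSpace ι₁ ι₂ ι₃)) := by
      rintro _ ⟨g, hg, rfl⟩
      rw [grayMap_add_grayMap]
      exact ⟨_, H.sub_mem (H.add_mem hh hg) (hc g hg), rfl⟩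
    change (fun c => grayMap h + c) '' _ = _
    refine Set.Subset.antisymm ?_ fun y hy => ⟨grayMap h + y, hsub y hy, ?_⟩
    · rintro _ ⟨y, hy, rfl⟩
      exact hsub y hy
    · change grayMap h + (grayMap h + y) = y
      rw [← add_assoc, hself, zero_add]

theorem isLinearCode_of_carry_mem (H : AddSubgroup (MixedSpace ι₁ ι₂ ι₃))
    (hH : ∀ h ∈ H, ∀ g ∈ H, carry h g ∈ H) :
    IsLinearCode (grayMap '' (H : Set (MixedSpace ι₁ ι₂ ι₃))) := by
  refine ⟨codeKernel (grayMap '' (H : Set (MixedSpace ι₁ ι₂ ι₃))), ?_⟩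
  ext x
  rw [SetLike.mem_coe, mem_codeKernel_grayMap_iff]
  constructor
  · rintro ⟨h, hh, rfl, -⟩
    exact ⟨h, hh, rfl⟩
  · rintro ⟨h, hh, rfl⟩
    exact ⟨h, hh, rfl, hH h hh⟩

end Carry

/-! ### The columns of the matrices -/

/-- The description of the columns of `A^{t₁,t₂,t₃}` on which the computation of the kernel rests.
Row `0` is `(1 ∣ 2 ∣ 4)`, the rows `1, …, t₁` have order 8, the next `t₂` rows order 4, and the
remaining ones order 2. The columns over `ℤ₂` are all vectors beginning with `1`. Those over `ℤ₄`
and `ℤ₈` are the normalised ones: their first unit is `1`, and it stands in one of the rows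
`1, …, t₁ + t₂`, respectively `1, …, t₁`; here the row of that unit is called `i`. Of this
description, the fields record that all these columns occur; of the converse they record only row
`0`, the bounds on the orders of the entries and, when a single row has order greater than 2, that
this row is `1` over `ℤ₄` and `ℤ₈`. -/
structure HasHadamardColumns (t₁ t₂ : ℕ) {r : ℕ} (M : MixedMatrix r) : Prop where
  exists_col₁ : ∀ f : Fin r → ZMod 2, (∀ k : Fin r, (k : ℕ) = 0 → f k = 1) →
    ∃ p, ∀ k, M.A₁ k p = f k
  exists_col₂ : ∀ f : Fin r → ZMod 4, (∀ k : Fin r, (k : ℕ) = 0 → f k = 2) →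
    ∀ i : Fin r, 1 ≤ (i : ℕ) → (i : ℕ) ≤ t₁ + t₂ → f i = 1 →
    (∀ k : Fin r, (k < i ∨ t₁ + t₂ < (k : ℕ)) → 2 * f k = 0) → ∃ p, ∀ k, M.A₂ k p = f k
  exists_col₃ : ∀ f : Fin r → ZMod 8, (∀ k : Fin r, (k : ℕ) = 0 → f k = 4) →
    ∀ i : Fin r, 1 ≤ (i : ℕ) → (i : ℕ) ≤ t₁ → f i = 1 →
    (∀ k : Fin r, (k < i ∨ t₁ < (k : ℕ)) → 4 * f k = 0) →
    (∀ k : Fin r, t₁ + t₂ < (k : ℕ) → 2 * f k = 0) → ∃ p, ∀ k, M.A₃ k p = f k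
  row_zero₂ : ∀ (k : Fin r) p, (k : ℕ) = 0 → M.A₂ k p = 2
  row_zero₃ : ∀ (k : Fin r) p, (k : ℕ) = 0 → M.A₃ k p = 4
  four_mul₃ : ∀ (k : Fin r) p, t₁ < (k : ℕ) → 4 * M.A₃ k p = 0
  two_mul₂ : ∀ (k : Fin r) p, t₁ + t₂ < (k : ℕ) → 2 * M.A₂ k p = 0
  two_mul₃ : ∀ (k : Fin r) p, t₁ + t₂ < (k : ℕ) → 2 * M.A₃ k p = 0
  row_one₂ : t₁ + t₂ = 1 → ∀ (k : Fin r) p, (k : ℕ) = 1 → M.A₂ k p = 1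
  row_one₃ : t₁ + t₂ = 1 → ∀ (k : Fin r) p, (k : ℕ) = 1 → M.A₃ k p = 1

section Blocks

variable {r n m s : ℕ} {ι : Type}

@[simp] theorem copies_castSucc (a : ZMod n) (B : Matrix (Fin r) ι (ZMod n)) (k : Fin r)
    (p : Fin m × ι) : copies m a B k.castSucc p = B k p.2 := by
  simp [copies]

@[simp] theorem copies_last (a : ZMod n) (B : Matrix (Fin r) ι (ZMod n)) (p : Fin m × ι) :
    copies m a B (Fin.last r) p = a * (p.1 : ℕ) := by
  simp [copies]

@[simp] theorem evenBlock_zero (a : ZMod n) (z : Fin s → Fin m) :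
    evenBlock s n m a (Fin.castSucc 0) z = a := by
  simp [evenBlock, -Fin.castSucc_zero]

@[simp] theorem evenBlock_succ (a : ZMod n) (k : Fin s) (z : Fin s → Fin m) :
    evenBlock s n m a k.succ.castSucc z = 2 * ((z k : ℕ) : ZMod n) := by
  simp [evenBlock, -Fin.castSucc_succ]

@[simp] theorem evenBlock_last (a : ZMod n) (z : Fin s → Fin m) :
    evenBlock s n m a (Fin.last (s + 1)) z = 1 := by
  simp [evenBlock]

theorem exists_copies_col {a : ZMod n} {B : Matrix (Fin r) ι (ZMod n)} {f : Fin (r + 1) → ZMod n}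
    (hB : ∃ p, ∀ k : Fin r, B k p = f k.castSucc)
    (hf : ∃ j : Fin m, a * ((j : ℕ) : ZMod n) = f (Fin.last r)) :
    ∃ p : Fin m × ι, ∀ k, copies m a B k p = f k := by
  obtain ⟨p, hp⟩ := hB
  obtain ⟨j, hj⟩ := hf
  refine ⟨(j, p), Fin.lastCases ?_ fun k => ?_⟩
  · simpa using hj
  · simpa using hp k

theorem exists_evenBlock_col {a : ZMod n} {f : Fin (s + 2) → ZMod n}
    (h0 : f (Fin.castSucc 0) = a)
    (hf : ∀ k : Fin s, ∃ j : Fin m, 2 * ((j : ℕ) : ZMod n) = f k.succ.castSucc)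
    (h1 : f (Fin.last (s + 1)) = 1) :
    ∃ z : Fin s → Fin m, ∀ k, evenBlock s n m a k z = f k := by
  choose z hz using hf
  refine ⟨z, Fin.lastCases ?_ fun k => ?_⟩
  · rw [evenBlock_last, h1]
  · refine Fin.cases ?_ (fun k => ?_) k
    · rw [evenBlock_zero, h0]
    · rw [evenBlock_succ, hz]

theorem forall_row_iff {P : Fin (r + 1) → Prop} :
    (∀ k, P k) ↔ (∀ k : Fin r, P k.castSucc) ∧ P (Fin.last r) :=
  ⟨fun h => ⟨fun _ => h _, h _⟩, fun h => Fin.lastCases h.2 h.1⟩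

end Blocks

theorem exists_fin_natCast₂ : ∀ x : ZMod 2, ∃ j : Fin 2, 1 * ((j : ℕ) : ZMod 2) = x := by decide

theorem exists_fin_natCast₄ : ∀ x : ZMod 4, ∃ j : Fin 4, 1 * ((j : ℕ) : ZMod 4) = x := by decide

theorem exists_fin_natCast₈ : ∀ x : ZMod 8, ∃ j : Fin 8, 1 * ((j : ℕ) : ZMod 8) = x := by decide

theorem exists_fin_two_mul₄ : ∀ x : ZMod 4, 2 * x = 0 →
    ∃ j : Fin 2, 2 * ((j : ℕ) : ZMod 4) = x := by decide

theorem exists_fin_two_mul₈ : ∀ x : ZMod 8, 4 * x = 0 →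
    ∃ j : Fin 4, 2 * ((j : ℕ) : ZMod 8) = x := by decide

theorem exists_fin_four_mul₈ : ∀ x : ZMod 8, 2 * x = 0 →
    ∃ j : Fin 2, 4 * ((j : ℕ) : ZMod 8) = x := by decide

theorem hasHadamardColumns_baseMatrix : HasHadamardColumns 1 0 baseMatrix where
  exists_col₁ f hf := by
    have h : ∀ x : ZMod 2, ∃ p : Fin 2,
        (!![1, 1; 0, 1] : Matrix (Fin 2) (Fin 2) (ZMod 2)) 0 p = 1 ∧
        (!![1, 1; 0, 1] : Matrix (Fin 2) (Fin 2) (ZMod 2)) 1 p = x := by decide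
    obtain ⟨p, hp⟩ := h (f 1)
    exact ⟨p, Fin.forall_fin_two.2 ⟨hp.1.trans (hf 0 rfl).symm, hp.2⟩⟩
  exists_col₂ f hf i hi hit hfi _ := by
    obtain rfl : i = 1 := Fin.ext (by simp; omega)
    exact ⟨(0 : Fin 1), Fin.forall_fin_two.2 ⟨(hf 0 rfl).symm, hfi.symm⟩⟩
  exists_col₃ f hf i hi hit hfi _ _ := by
    obtain rfl : i = 1 := Fin.ext (by simp; omega)
    exact ⟨(0 : Fin 1), Fin.forall_fin_two.2 ⟨(hf 0 rfl).symm, hfi.symm⟩⟩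
  row_zero₂ := Fin.forall_fin_two.2
    ⟨fun p _ => by
      obtain rfl : p = (0 : Fin 1) := Subsingleton.elim (α := Fin 1) _ _
      rfl, fun _ h => absurd h one_ne_zero⟩
  row_zero₃ := Fin.forall_fin_two.2
    ⟨fun p _ => by
      obtain rfl : p = (0 : Fin 1) := Subsingleton.elim (α := Fin 1) _ _
      rfl, fun _ h => absurd h one_ne_zero⟩
  four_mul₃ k p hk := by omega
  two_mul₂ k p hk := by omega
  two_mul₃ k p hk := by omega
  row_one₂ _ := Fin.forall_fin_two.2
    ⟨fun _ h => absurd h zero_ne_one, fun p _ => by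
      obtain rfl : p = (0 : Fin 1) := Subsingleton.elim (α := Fin 1) _ _
      rfl⟩
  row_one₃ _ := Fin.forall_fin_two.2
    ⟨fun _ h => absurd h zero_ne_one, fun p _ => by
      obtain rfl : p = (0 : Fin 1) := Subsingleton.elim (α := Fin 1) _ _
      rfl⟩

namespace HasHadamardColumns

/-- The block over `ℤ₂` is extended in the same way by `addRow8`, `addRow4` and `addRow2`. -/
theorem exists_copies_col₁ {t₁ t₂ r : ℕ} {M : MixedMatrix r} (hM : HasHadamardColumns t₁ t₂ M)
    (f : Fin (r + 1) → ZMod 2) (hf : ∀ k : Fin (r + 1), (k : ℕ) = 0 → f k = 1) :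
    ∃ p : Fin 2 × M.ι₁, ∀ k, copies 2 1 M.A₁ k p = f k :=
  exists_copies_col (hM.exists_col₁ _ fun k hk => hf _ (by simpa using hk))
    (exists_fin_natCast₂ _)

/-- The columns over `ℤ₄` of `addRow8 M` and `addRow4 M`. A column whose first unit is in the new
row is found in the block of even vectors, the others in the copies of `A₂`. -/
theorem exists_fromCols_col₂ {t₁ t₂ s : ℕ} {M : MixedMatrix (s + 1)}
    (hM : HasHadamardColumns t₁ t₂ M) (hs : s = t₁ + t₂) (f : Fin (s + 2) → ZMod 4)
    (hf : ∀ k : Fin (s + 2), (k : ℕ) = 0 → f k = 2) (i : Fin (s + 2)) (hi : 1 ≤ (i : ℕ))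
    (hfi : f i = 1) (hfk : ∀ k : Fin (s + 2), k < i → 2 * f k = 0) :
    ∃ p : (Fin s → Fin 2) ⊕ (Fin 4 × M.ι₂), ∀ k,
      Matrix.fromCols (evenBlock s 4 2 2) (copies 4 1 M.A₂) k p = f k := by
  induction i using Fin.lastCases with
  | last =>
    obtain ⟨z, hz⟩ := exists_evenBlock_col (m := 2) (hf (Fin.castSucc 0) rfl)
      (fun k => exists_fin_two_mul₄ _ (hfk k.succ.castSucc (Fin.castSucc_lt_last _))) hfi
    exact ⟨Sum.inl z, hz⟩
  | cast i =>
    obtain ⟨p, hp⟩ := exists_copies_col (a := 1) (B := M.A₂) (f := f) (m := 4)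
      (hM.exists_col₂ _ (fun k hk => hf _ (by simpa using hk)) i (by simpa using hi) (by omega) hfi
        (fun k hk => hfk _ (by rcases hk with hk | hk <;> [exact hk; omega])))
      (exists_fin_natCast₄ _)
    exact ⟨Sum.inr p, hp⟩

theorem addRow8 {t₁ s : ℕ} {M : MixedMatrix (s + 1)} (hM : HasHadamardColumns t₁ 0 M)
    (hs : s = t₁) (ht : 1 ≤ t₁) : HasHadamardColumns (t₁ + 1) 0 (addRow8 M) where
  exists_col₁ := hM.exists_copies_col₁
  exists_col₂ f hf i hi _ hfi hfk :=
    hM.exists_fromCols_col₂ (by omega) f hf i hi hfi fun k hk => hfk k (Or.inl hk)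
  exists_col₃ f hf i hi _ hfi hfk _ := by
    induction i using Fin.lastCases with
    | last =>
      obtain ⟨z, hz⟩ := exists_evenBlock_col (m := 4) (hf (Fin.castSucc 0) rfl)
        (fun k => exists_fin_two_mul₈ _
          (hfk k.succ.castSucc (Or.inl (Fin.castSucc_lt_last _)))) hfi
      exact ⟨Sum.inl z, hz⟩
    | cast i =>
      obtain ⟨p, hp⟩ := exists_copies_col (a := 1) (B := M.A₃) (f := f) (m := 8)
        (hM.exists_col₃ _ (fun k hk => hf _ (by simpa using hk)) i (by simpa using hi) (by omega)
          hfi (fun k hk => hfk _ (by rcases hk with hk | hk <;> [exact Or.inl hk; omega]))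
          (fun k hk => by omega))
        (exists_fin_natCast₈ _)
      exact ⟨Sum.inr p, hp⟩
  row_zero₂ := by
    refine forall_row_iff.2 ⟨fun k p hk => ?_, fun p hk => by simp at hk⟩
    rcases p with z | p
    · obtain rfl : k = 0 := Fin.ext (by simpa using hk)
      exact evenBlock_zero (n := 4) (m := 2) 2 z
    · exact (copies_castSucc _ _ _ _).trans (hM.row_zero₂ k p.2 (by simpa using hk))
  row_zero₃ := by
    refine forall_row_iff.2 ⟨fun k p hk => ?_, fun p hk => by simp at hk⟩
    rcases p with z | p
    · obtain rfl : k = 0 := Fin.ext (by simpa using hk)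
      exact evenBlock_zero (n := 8) (m := 4) 4 z
    · exact (copies_castSucc _ _ _ _).trans (hM.row_zero₃ k p.2 (by simpa using hk))
  four_mul₃ k p hk := by omega
  two_mul₂ k p hk := by omega
  two_mul₃ k p hk := by omega
  row_one₂ h := by omega
  row_one₃ h := by omega

theorem addRow4 {t₁ t₂ s : ℕ} {M : MixedMatrix (s + 1)} (hM : HasHadamardColumns t₁ t₂ M)
    (hs : s = t₁ + t₂) (ht : 1 ≤ t₁) : HasHadamardColumns t₁ (t₂ + 1) (addRow4 M) where
  exists_col₁ := hM.exists_copies_col₁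
  exists_col₂ f hf i hi _ hfi hfk :=
    hM.exists_fromCols_col₂ hs f hf i hi hfi fun k hk => hfk k (Or.inl hk)
  exists_col₃ f hf i hi hit hfi hfk _ := by
    induction i using Fin.lastCases with
    | last => simp at hit; omega
    | cast i =>
      exact exists_copies_col (a := 2) (B := M.A₃) (f := f) (m := 4)
        (hM.exists_col₃ _ (fun k hk => hf _ (by simpa using hk)) i (by simpa using hi)
          (by simpa using hit) hfi (fun k hk => hfk k.castSucc hk) (fun k hk => by omega))
        (exists_fin_two_mul₈ _ (hfk _ (Or.inr (by simp; omega))))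
  row_zero₂ := by
    refine forall_row_iff.2 ⟨fun k p hk => ?_, fun p hk => by simp at hk⟩
    rcases p with z | p
    · obtain rfl : k = 0 := Fin.ext (by simpa using hk)
      exact evenBlock_zero (n := 4) (m := 2) 2 z
    · exact (copies_castSucc _ _ _ _).trans (hM.row_zero₂ k p.2 (by simpa using hk))
  row_zero₃ := by
    refine forall_row_iff.2 ⟨fun k p hk => ?_, fun p hk => by simp at hk⟩
    exact (copies_castSucc _ _ _ _).trans (hM.row_zero₃ k p.2 (by simpa using hk))
  four_mul₃ := by
    have h8 : ∀ j : Fin 4, (4 : ZMod 8) * (2 * ((j : ℕ) : ZMod 8)) = 0 := by decide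
    refine forall_row_iff.2 ⟨fun k p hk => ?_, fun p _ => ?_⟩
    · exact (congrArg _ (copies_castSucc _ _ _ _)).trans (hM.four_mul₃ k p.2 (by simpa using hk))
    · exact (congrArg _ (copies_last _ _ _)).trans (h8 p.1)
  two_mul₂ k p hk := by omega
  two_mul₃ k p hk := by omega
  row_one₂ h := by omega
  row_one₃ h := by omega

theorem addRow2 {t₁ t₂ r : ℕ} {M : MixedMatrix r} (hM : HasHadamardColumns t₁ t₂ M)
    (hr : t₁ + t₂ < r) (ht : 1 ≤ t₁) : HasHadamardColumns t₁ t₂ (addRow2 M) where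
  exists_col₁ := hM.exists_copies_col₁
  exists_col₂ f hf i hi hit hfi hfk := by
    induction i using Fin.lastCases with
    | last => simp at hit; omega
    | cast i =>
      exact exists_copies_col
        (hM.exists_col₂ _ (fun k hk => hf _ (by simpa using hk)) i (by simpa using hi)
          (by simpa using hit) hfi (fun k hk => hfk k.castSucc hk))
        (exists_fin_two_mul₄ _ (hfk _ (Or.inr (by simpa using hr))))
  exists_col₃ f hf i hi hit hfi hfk hfk' := by
    induction i using Fin.lastCases with
    | last => simp at hit; omega
    | cast i =>
      exact exists_copies_col
        (hM.exists_col₃ _ (fun k hk => hf _ (by simpa using hk)) i (by simpa using hi)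
          (by simpa using hit) hfi (fun k hk => hfk k.castSucc hk) (fun k hk => hfk' k.castSucc hk))
        (exists_fin_four_mul₈ _ (hfk' _ (by simpa using hr)))
  row_zero₂ := by
    refine forall_row_iff.2 ⟨fun k p hk => ?_, fun p hk => by simp at hk; omega⟩
    exact (copies_castSucc _ _ _ _).trans (hM.row_zero₂ k p.2 (by simpa using hk))
  row_zero₃ := by
    refine forall_row_iff.2 ⟨fun k p hk => ?_, fun p hk => by simp at hk; omega⟩
    exact (copies_castSucc _ _ _ _).trans (hM.row_zero₃ k p.2 (by simpa using hk))
  four_mul₃ := by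
    have h8 : ∀ j : Fin 2, (4 : ZMod 8) * (4 * ((j : ℕ) : ZMod 8)) = 0 := by decide
    refine forall_row_iff.2 ⟨fun k p hk => ?_, fun p _ => ?_⟩
    · exact (congrArg _ (copies_castSucc _ _ _ _)).trans (hM.four_mul₃ k p.2 (by simpa using hk))
    · exact (congrArg _ (copies_last _ _ _)).trans (h8 p.1)
  two_mul₂ := by
    have h4 : ∀ j : Fin 2, (2 : ZMod 4) * (2 * ((j : ℕ) : ZMod 4)) = 0 := by decide
    refine forall_row_iff.2 ⟨fun k p hk => ?_, fun p _ => ?_⟩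
    · exact (congrArg _ (copies_castSucc _ _ _ _)).trans (hM.two_mul₂ k p.2 (by simpa using hk))
    · exact (congrArg _ (copies_last _ _ _)).trans (h4 p.1)
  two_mul₃ := by
    have h8 : ∀ j : Fin 2, (2 : ZMod 8) * (4 * ((j : ℕ) : ZMod 8)) = 0 := by decide
    refine forall_row_iff.2 ⟨fun k p hk => ?_, fun p _ => ?_⟩
    · exact (congrArg _ (copies_castSucc _ _ _ _)).trans (hM.two_mul₃ k p.2 (by simpa using hk))
    · exact (congrArg _ (copies_last _ _ _)).trans (h8 p.1)
  row_one₂ h := by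
    refine forall_row_iff.2 ⟨fun k p hk => ?_, fun p hk => by simp at hk; omega⟩
    exact (copies_castSucc _ _ _ _).trans (hM.row_one₂ h k p.2 (by simpa using hk))
  row_one₃ h := by
    refine forall_row_iff.2 ⟨fun k p hk => ?_, fun p hk => by simp at hk; omega⟩
    exact (copies_castSucc _ _ _ _).trans (hM.row_one₃ h k p.2 (by simpa using hk))

theorem castRows {t₁ t₂ r r' : ℕ} {M : MixedMatrix r} (hM : HasHadamardColumns t₁ t₂ M)
    (h : r = r') : HasHadamardColumns t₁ t₂ (M.castRows h) := by
  subst h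
  exact hM

end HasHadamardColumns

theorem hasHadamardColumns_matrixA8 (a : ℕ) : HasHadamardColumns (a + 1) 0 (matrixA8 a) := by
  induction a with
  | zero => exact hasHadamardColumns_baseMatrix
  | succ a ih => exact ih.addRow8 rfl (by omega)

theorem hasHadamardColumns_matrixA84 (a b : ℕ) :
    HasHadamardColumns (a + 1) b (matrixA84 a b) := by
  induction b with
  | zero => exact hasHadamardColumns_matrixA8 a
  | succ b ih => exact ih.addRow4 rfl (by omega)

theorem hasHadamardColumns_matrixA842 (a b c : ℕ) :
    HasHadamardColumns (a + 1) b (matrixA842 a b c) := by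
  induction c with
  | zero => exact hasHadamardColumns_matrixA84 a b
  | succ c ih => exact ih.addRow2 (by omega) (by omega)

theorem hasHadamardColumns_matrixA (t₁ t₂ t₃ : ℕ) (h₁ : 1 ≤ t₁) (h₃ : 1 ≤ t₃) :
    HasHadamardColumns t₁ t₂ (matrixA t₁ t₂ t₃ h₁ h₃) := by
  obtain ⟨a, rfl⟩ := Nat.exists_eq_add_of_le' h₁
  exact (hasHadamardColumns_matrixA842 a t₂ (t₃ - 1)).castRows _

/-! ### Orders of the rows and independence -/

/-- The order of row `k` of `A^{t₁,t₂,t₃}`. -/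
def rowOrder (t₁ t₂ k : ℕ) : ℕ :=
  if k = 0 then 2 else if k ≤ t₁ then 8 else if k ≤ t₁ + t₂ then 4 else 2

theorem rowOrder_cases (t₁ t₂ k : ℕ) :
    ((k = 0 ∨ t₁ + t₂ < k) ∧ rowOrder t₁ t₂ k = 2) ∨
      ((t₁ < k ∧ 1 ≤ k ∧ k ≤ t₁ + t₂) ∧ rowOrder t₁ t₂ k = 4) ∨
      ((1 ≤ k ∧ k ≤ t₁) ∧ rowOrder t₁ t₂ k = 8) := by
  unfold rowOrder
  split_ifs <;> omega

theorem two_mul_rowOrder_div_two (t₁ t₂ k : ℕ) :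
    2 * (rowOrder t₁ t₂ k / 2) = rowOrder t₁ t₂ k := by
  rcases rowOrder_cases t₁ t₂ k with h | h | h <;> omega

theorem mem_additiveCode_iff {r : ℕ} {M : MixedMatrix r} {h : MixedSpace M.ι₁ M.ι₂ M.ι₃} :
    h ∈ M.additiveCode ↔ ∃ a : Fin r → ℤ, ∑ k, a k • M.row k = h := by
  rw [additiveCode, ← Submodule.span_int_eq_addSubgroupClosure, Submodule.mem_toAddSubgroup,
    Submodule.mem_span_range_iff_exists_fun]

theorem row_mem_additiveCode {r : ℕ} (M : MixedMatrix r) (k : Fin r) :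
    M.row k ∈ M.additiveCode :=
  AddSubgroup.subset_closure ⟨k, rfl⟩

section Evaluation

variable {r : ℕ} {M : MixedMatrix r} (a : Fin r → ℤ)

theorem sum_zsmul_row_apply₁ (p : M.ι₁) :
    (∑ k, a k • M.row k).1 p = ∑ k, (a k : ZMod 2) * M.A₁ k p := by
  simp [Prod.fst_sum, row, zsmul_eq_mul]

theorem sum_zsmul_row_apply₂ (p : M.ι₂) :
    (∑ k, a k • M.row k).2.1 p = ∑ k, (a k : ZMod 4) * M.A₂ k p := by
  simp [Prod.fst_sum, Prod.snd_sum, row, zsmul_eq_mul]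

theorem sum_zsmul_row_apply₃ (p : M.ι₃) :
    (∑ k, a k • M.row k).2.2 p = ∑ k, (a k : ZMod 8) * M.A₃ k p := by
  simp [Prod.snd_sum, row, zsmul_eq_mul]

end Evaluation

namespace HasHadamardColumns

variable {t₁ t₂ r : ℕ} {M : MixedMatrix r}

theorem rowOrder_nsmul_row (hM : HasHadamardColumns t₁ t₂ M) (k : Fin r) :
    rowOrder t₁ t₂ k • M.row k = 0 := by
  have e2 : ∀ x : ZMod 2, 2 • x = 0 ∧ 4 • x = 0 ∧ 8 • x = 0 := by decide
  have e4 : ∀ x : ZMod 4, 4 • x = 0 ∧ 8 • x = 0 := by decide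
  have e8 : ∀ x : ZMod 8, 8 • x = 0 := by decide
  refine Prod.ext (funext fun p => ?_) (Prod.ext (funext fun p => ?_) (funext fun p => ?_))
  · change rowOrder t₁ t₂ k • M.A₁ k p = 0
    rcases rowOrder_cases t₁ t₂ k with ⟨-, h⟩ | ⟨-, h⟩ | ⟨-, h⟩ <;> rw [h]
    exacts [(e2 _).1, (e2 _).2.1, (e2 _).2.2]
  · change rowOrder t₁ t₂ k • M.A₂ k p = 0
    rcases rowOrder_cases t₁ t₂ k with ⟨hk | hk, h⟩ | ⟨-, h⟩ | ⟨-, h⟩ <;> rw [h]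
    · rw [hM.row_zero₂ k p hk]
      rfl
    · exact (nsmul_eq_mul _ _).trans (hM.two_mul₂ k p hk)
    exacts [(e4 _).1, (e4 _).2]
  · change rowOrder t₁ t₂ k • M.A₃ k p = 0
    rcases rowOrder_cases t₁ t₂ k with ⟨hk | hk, h⟩ | ⟨hk, h⟩ | ⟨-, h⟩ <;> rw [h]
    · rw [hM.row_zero₃ k p hk]
      rfl
    · exact (nsmul_eq_mul _ _).trans (hM.two_mul₃ k p hk)
    · exact (nsmul_eq_mul _ _).trans (hM.four_mul₃ k p hk.1)
    · exact e8 _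

/-- The column `2 e₀ + e_i` over `ℤ₄`. -/
theorem exists_unit_col₂ (hM : HasHadamardColumns t₁ t₂ M) {z i : Fin r} (hz : (z : ℕ) = 0)
    (hi : 1 ≤ (i : ℕ)) (hit : (i : ℕ) ≤ t₁ + t₂) :
    ∃ p, ∀ a : Fin r → ℤ,
      (∑ k, a k • M.row k).2.1 p = ((2 * a z + a i : ℤ) : ZMod 4) := by
  have hzi : i ≠ z := fun h => by rw [h] at hi; omega
  obtain ⟨p, hp⟩ := hM.exists_col₂ (Pi.single z 2 + Pi.single i 1)
    (fun k hk => by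
      obtain rfl : k = z := Fin.ext (by omega)
      simp [hzi.symm])
    i hi hit (by simp [hzi])
    (fun k hk => by
      have hki : k ≠ i := by rintro rfl; rcases hk with hk | hk <;> [exact lt_irrefl _ hk; omega]
      by_cases h : k = z
      · subst h; simp [hki]; rfl
      · simp [hki, h])
  refine ⟨p, fun a => ?_⟩
  rw [sum_zsmul_row_apply₂]
  simp [hp, mul_add, Finset.sum_add_distrib, Pi.single_apply, mul_comm]

/-- The column `2 e₀ + e_i + e_j` over `ℤ₄`. -/
theorem exists_add_col₂ (hM : HasHadamardColumns t₁ t₂ M) {z i j : Fin r} (hz : (z : ℕ) = 0)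
    (hi : 1 ≤ (i : ℕ)) (hit : (i : ℕ) ≤ t₁ + t₂) (hj : 1 ≤ (j : ℕ)) (hjt : (j : ℕ) ≤ t₁ + t₂)
    (hij : i ≠ j) :
    ∃ p, ∀ a : Fin r → ℤ,
      (∑ k, a k • M.row k).2.1 p = ((2 * a z + a i + a j : ℤ) : ZMod 4) := by
  wlog hlt : i < j generalizing i j
  · obtain ⟨p, hp⟩ := this hj hjt hi hit hij.symm (lt_of_le_of_ne (not_lt.1 hlt) hij.symm)
    exact ⟨p, fun a => by rw [hp, add_right_comm]⟩
  have hzi : i ≠ z := fun h => by rw [h] at hi; omega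
  have hzj : j ≠ z := fun h => by rw [h] at hj; omega
  obtain ⟨p, hp⟩ := hM.exists_col₂ (Pi.single z 2 + Pi.single i 1 + Pi.single j 1)
    (fun k hk => by
      obtain rfl : k = z := Fin.ext (by omega)
      simp [hzi.symm, hzj.symm])
    i hi hit (by simp [hzi, hij])
    (fun k hk => by
      have hki : k ≠ i := by rintro rfl; rcases hk with hk | hk <;> [exact lt_irrefl _ hk; omega]
      have hkj : k ≠ j := by rintro rfl; rcases hk with hk | hk <;> [exact lt_asymm hk hlt; omega]
      by_cases h : k = z
      · subst h; simp [hki, hkj]; rfl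
      · simp [hki, hkj, h])
  refine ⟨p, fun a => ?_⟩
  rw [sum_zsmul_row_apply₂]
  simp [hp, mul_add, Finset.sum_add_distrib, Pi.single_apply, mul_comm]

/-- The column `4 e₀ + e_i` over `ℤ₈`. -/
theorem exists_unit_col₃ (hM : HasHadamardColumns t₁ t₂ M) {z i : Fin r} (hz : (z : ℕ) = 0)
    (hi : 1 ≤ (i : ℕ)) (hit : (i : ℕ) ≤ t₁) :
    ∃ p, ∀ a : Fin r → ℤ,
      (∑ k, a k • M.row k).2.2 p = ((4 * a z + a i : ℤ) : ZMod 8) := by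
  have hzi : i ≠ z := fun h => by rw [h] at hi; omega
  have h8 : (4 * 4 : ZMod 8) = 0 := rfl
  obtain ⟨p, hp⟩ := hM.exists_col₃ (Pi.single z 4 + Pi.single i 1)
    (fun k hk => by
      obtain rfl : k = z := Fin.ext (by omega)
      simp [hzi.symm])
    i hi hit (by simp [hzi])
    (fun k hk => by
      have hki : k ≠ i := by rintro rfl; rcases hk with hk | hk <;> [exact lt_irrefl _ hk; omega]
      by_cases h : k = z
      · subst h; simp [hki, h8]
      · simp [hki, h])
    (fun k hk => by
      have hki : k ≠ i := by rintro rfl; omega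
      have hkz : k ≠ z := by rintro rfl; omega
      simp [hki, hkz])
  refine ⟨p, fun a => ?_⟩
  rw [sum_zsmul_row_apply₃]
  simp [hp, mul_add, Finset.sum_add_distrib, Pi.single_apply, mul_comm]

/-- The column `4 e₀ + e_i + 2 e_j` over `ℤ₈`. -/
theorem exists_add_col₃ (hM : HasHadamardColumns t₁ t₂ M) {z i j : Fin r} (hz : (z : ℕ) = 0)
    (hi : 1 ≤ (i : ℕ)) (hit : (i : ℕ) ≤ t₁) (hj : 1 ≤ (j : ℕ)) (hjt : (j : ℕ) ≤ t₁ + t₂)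
    (hij : i ≠ j) :
    ∃ p, ∀ a : Fin r → ℤ,
      (∑ k, a k • M.row k).2.2 p = ((4 * a z + a i + 2 * a j : ℤ) : ZMod 8) := by
  have hzi : i ≠ z := fun h => by rw [h] at hi; omega
  have hzj : j ≠ z := fun h => by rw [h] at hj; omega
  have h8 : (4 * 4 : ZMod 8) = 0 := rfl
  have h8' : (4 * 2 : ZMod 8) = 0 := rfl
  obtain ⟨p, hp⟩ := hM.exists_col₃
    (Pi.single z 4 + Pi.single i 1 + Pi.single j 2)
    (fun k hk => by
      obtain rfl : k = z := Fin.ext (by omega)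
      simp [hzi.symm, hzj.symm])
    i hi hit (by simp [hzi, hij])
    (fun k hk => by
      have hki : k ≠ i := by rintro rfl; rcases hk with hk | hk <;> [exact lt_irrefl _ hk; omega]
      by_cases h : k = z
      · subst h; simp [hki, hzj.symm, h8]
      · by_cases h' : k = j
        · subst h'; simp [hki, h, h8']
        · simp [hki, h', h])
    (fun k hk => by
      have hki : k ≠ i := by rintro rfl; omega
      have hkj : k ≠ j := by rintro rfl; omega
      have hkz : k ≠ z := by rintro rfl; omega
      simp [hki, hkj, hkz])
  refine ⟨p, fun a => ?_⟩
  rw [sum_zsmul_row_apply₃]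
  simp [hp, mul_add, Finset.sum_add_distrib, Pi.single_apply, mul_comm]

/-- A codeword that vanishes on the coordinates over `ℤ₂` has even coefficients. -/
theorem two_dvd_of_fst_eq_zero (hM : HasHadamardColumns t₁ t₂ M) (a : Fin r → ℤ)
    (h : (∑ k, a k • M.row k).1 = 0) (k : Fin r) : 2 ∣ a k := by
  have hz : ∀ z : Fin r, (z : ℕ) = 0 → 2 ∣ a z := by
    intro z hz
    obtain ⟨p, hp⟩ := hM.exists_col₁ (Pi.single z 1)
      (fun k hk => by obtain rfl : k = z := Fin.ext (by omega); simp)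
    have := congrFun h p
    rw [sum_zsmul_row_apply₁] at this
    simp only [hp, Pi.single_apply, mul_ite, mul_one, mul_zero, Finset.sum_ite_eq',
      Finset.mem_univ, if_true, Pi.zero_apply] at this
    exact (ZMod.intCast_zmod_eq_zero_iff_dvd _ 2).1 this
  by_cases hk : (k : ℕ) = 0
  · exact hz k hk
  have hr : 0 < r := by omega
  set z : Fin r := ⟨0, hr⟩ with hzdef
  have hkz : k ≠ z := fun h => hk (by rw [h])
  obtain ⟨p, hp⟩ := hM.exists_col₁ (Pi.single z 1 + Pi.single k 1)
    (fun l hl => by obtain rfl : l = z := Fin.ext (by simpa using hl); simp [hkz.symm])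
  have := congrFun h p
  rw [sum_zsmul_row_apply₁] at this
  simp only [hp, Pi.add_apply, mul_add, Finset.sum_add_distrib, Pi.single_apply, mul_ite, mul_one,
    mul_zero, Finset.sum_ite_eq', Finset.mem_univ, if_true, Pi.zero_apply] at this
  have h' : 2 ∣ a z + a k := (ZMod.intCast_zmod_eq_zero_iff_dvd _ 2).1 (by push_cast; exact this)
  have := hz z rfl
  omega

/-- The only relations between the rows are those given by their orders. -/
theorem sum_zsmul_row_eq_zero_iff (hM : HasHadamardColumns t₁ t₂ M) (hr : t₁ + t₂ < r)
    (a : Fin r → ℤ) :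
    ∑ k, a k • M.row k = 0 ↔ ∀ k : Fin r, (rowOrder t₁ t₂ k : ℤ) ∣ a k := by
  constructor
  · intro h k
    have heven := hM.two_dvd_of_fst_eq_zero a (congrArg Prod.fst h)
    have hz := heven ⟨0, by omega⟩
    rcases rowOrder_cases t₁ t₂ k with ⟨-, ho⟩ | ⟨hk, ho⟩ | ⟨hk, ho⟩ <;> rw [ho]
    · exact heven k
    · obtain ⟨p, hp⟩ := hM.exists_unit_col₂ (z := ⟨0, by omega⟩) rfl hk.2.1 hk.2.2
      have := (ZMod.intCast_zmod_eq_zero_iff_dvd _ 4).1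
        ((hp a).symm.trans (congrFun (congrArg (fun w => w.2.1) h) p))
      push_cast at this ⊢
      omega
    · obtain ⟨p, hp⟩ := hM.exists_unit_col₃ (z := ⟨0, by omega⟩) rfl hk.1 hk.2
      have := (ZMod.intCast_zmod_eq_zero_iff_dvd _ 8).1
        ((hp a).symm.trans (congrFun (congrArg (fun w => w.2.2) h) p))
      push_cast at this ⊢
      omega
  · intro h
    refine Finset.sum_eq_zero fun k _ => ?_
    obtain ⟨c, hc⟩ := h k
    rw [hc, mul_comm, mul_smul, natCast_zsmul, hM.rowOrder_nsmul_row, smul_zero]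

theorem addOrderOf_row (hM : HasHadamardColumns t₁ t₂ M) (hr : t₁ + t₂ < r) (k : Fin r) :
    addOrderOf (M.row k) = rowOrder t₁ t₂ k := by
  refine Nat.dvd_antisymm (addOrderOf_dvd_of_nsmul_eq_zero (hM.rowOrder_nsmul_row k)) ?_
  have h : ∑ l, (Pi.single k (addOrderOf (M.row k) : ℤ) : Fin r → ℤ) l • M.row l = 0 := by
    rw [Finset.sum_eq_single k (fun l _ hl => by rw [Pi.single_eq_of_ne hl, zero_smul])
      (fun hk => absurd (Finset.mem_univ k) hk), Pi.single_eq_same, natCast_zsmul,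
      addOrderOf_nsmul_eq_zero]
  have := (hM.sum_zsmul_row_eq_zero_iff hr _).1 h k
  rw [Pi.single_eq_same] at this
  exact_mod_cast this

/-! ### Codewords whose carries are codewords -/

/-- If `h = ∑ a_k w_k` has its carries with all codewords in the code, then `a_i` is even for every
row `w_i` of order at least 4: modulo 2, the product of two distinct nonzero linear forms is not a
linear form. -/
theorem two_dvd_of_carry_mem (hM : HasHadamardColumns t₁ t₂ M) {a : Fin r → ℤ}
    (ha : ∀ g ∈ M.additiveCode, carry (∑ k, a k • M.row k) g ∈ M.additiveCode)
    {i j : Fin r} (hi : 1 ≤ (i : ℕ)) (hit : (i : ℕ) ≤ t₁ + t₂) (hj : 1 ≤ (j : ℕ))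
    (hjt : (j : ℕ) ≤ t₁ + t₂) (hij : i ≠ j) : 2 ∣ a i := by
  have hand : ∀ u : ZMod 4, 2 * ((u.val &&& (1 : ZMod 4).val : ℕ) : ZMod 4) = 2 * u := by
    decide +kernel
  obtain ⟨b, hb⟩ := mem_additiveCode_iff.1 (ha _ (row_mem_additiveCode M j))
  obtain ⟨z, hz⟩ : ∃ z : Fin r, (z : ℕ) = 0 := ⟨⟨0, by omega⟩, rfl⟩
  have hzj : z ≠ j := by rintro rfl; omega
  have hb0 := hM.two_dvd_of_fst_eq_zero b (by rw [hb]; rfl) z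
  have hrow : ∑ k, (Pi.single j 1 : Fin r → ℤ) k • M.row k = M.row j := by
    simp [Pi.single_apply, ite_smul]
  obtain ⟨p, hp⟩ := hM.exists_unit_col₂ hz hi hit
  obtain ⟨q, hq⟩ := hM.exists_unit_col₂ hz hj hjt
  obtain ⟨s, hs⟩ := hM.exists_add_col₂ hz hi hit hj hjt hij
  -- The carry with `w_j` at the columns `e_i`, `e_j` and `e_i + e_j`, where `w_j` is `0`, `1`, `1`.
  have h₁ := (hp b).symm.trans (congrFun (congrArg (fun w => w.2.1) hb) p)
  have h₂ := (hq b).symm.trans (congrFun (congrArg (fun w => w.2.1) hb) q)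
  have h₃ := (hs b).symm.trans (congrFun (congrArg (fun w => w.2.1) hb) s)
  simp only [carry] at h₁ h₂ h₃
  rw [hp a, ← hrow, hp] at h₁
  rw [hq a, ← hrow, hq] at h₂
  rw [hs a, ← hrow, hs] at h₃
  simp only [Pi.single_eq_same, Pi.single_eq_of_ne hzj, Pi.single_eq_of_ne hij, mul_zero, zero_add,
    Int.cast_zero, Int.cast_one, ZMod.val_zero, Nat.and_zero, Nat.cast_zero, hand] at h₁ h₂ h₃
  have h₁ := (ZMod.intCast_zmod_eq_zero_iff_dvd _ 4).1 h₁
  have h₂ := (ZMod.intCast_eq_intCast_iff_dvd_sub _ (2 * (2 * a z + a j)) 4).1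
    (h₂.trans (by push_cast; rfl))
  have h₃ := (ZMod.intCast_eq_intCast_iff_dvd_sub _ (2 * (2 * a z + a i + a j)) 4).1
    (h₃.trans (by push_cast; rfl))
  push_cast at h₁ h₂ h₃
  omega

/-- Moreover `4 ∣ a_i` if `w_i` has order 8: otherwise the carry of `h` with `w_j` distinguishes the
columns `e_i` and `e_i + 2 e_j`, although `b_j` is a multiple of 4 in every codeword `∑ b_k w_k`
that could be this carry. -/
theorem four_dvd_of_carry_mem (hM : HasHadamardColumns t₁ t₂ M) {a : Fin r → ℤ}
    (ha : ∀ g ∈ M.additiveCode, carry (∑ k, a k • M.row k) g ∈ M.additiveCode)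
    {i j : Fin r} (hi : 1 ≤ (i : ℕ)) (hit : (i : ℕ) ≤ t₁) (hj : 1 ≤ (j : ℕ))
    (hjt : (j : ℕ) ≤ t₁ + t₂) (hij : i ≠ j) : 4 ∣ a i := by
  have hand : ∀ u : ZMod 4, 2 * ((u.val &&& (1 : ZMod 4).val : ℕ) : ZMod 4) = 2 * u := by
    decide +kernel
  have hand' : ∀ u : ZMod 8, 4 * u = 0 →
      2 * ((u.val &&& (2 : ZMod 8).val : ℕ) : ZMod 8) = 2 * u := by
    decide +kernel
  have hai := hM.two_dvd_of_carry_mem ha hi (by omega) hj hjt hij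
  have haj := hM.two_dvd_of_carry_mem ha hj hjt hi (by omega) hij.symm
  obtain ⟨b, hb⟩ := mem_additiveCode_iff.1 (ha _ (row_mem_additiveCode M j))
  obtain ⟨z, hz⟩ : ∃ z : Fin r, (z : ℕ) = 0 := ⟨⟨0, by omega⟩, rfl⟩
  have hzj : z ≠ j := by rintro rfl; omega
  have hb0 := hM.two_dvd_of_fst_eq_zero b (by rw [hb]; rfl) z
  have hrow : ∑ k, (Pi.single j 1 : Fin r → ℤ) k • M.row k = M.row j := by
    simp [Pi.single_apply, ite_smul]
  obtain ⟨p, hp⟩ := hM.exists_unit_col₃ hz hi hit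
  obtain ⟨q, hq⟩ := hM.exists_unit_col₂ hz hj hjt
  obtain ⟨s, hs⟩ := hM.exists_add_col₃ hz hi hit hj hjt hij
  have h₁ := (hp b).symm.trans (congrFun (congrArg (fun w => w.2.2) hb) p)
  have h₂ := (hq b).symm.trans (congrFun (congrArg (fun w => w.2.1) hb) q)
  have h₃ := (hs b).symm.trans (congrFun (congrArg (fun w => w.2.2) hb) s)
  simp only [carry] at h₁ h₂ h₃
  rw [hp a, ← hrow, hp] at h₁
  rw [hq a, ← hrow, hq] at h₂
  rw [hs a, ← hrow, hs] at h₃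
  simp only [Pi.single_eq_same, Pi.single_eq_of_ne hzj, Pi.single_eq_of_ne hij, mul_zero, zero_add,
    mul_one, Int.cast_zero, Int.cast_one, Int.cast_ofNat, ZMod.val_zero, Nat.and_zero,
    Nat.cast_zero, hand] at h₁ h₂ h₃
  have heven : (4 : ZMod 8) * ((4 * a z + a i + 2 * a j : ℤ) : ZMod 8) = 0 := by
    have := (ZMod.intCast_zmod_eq_zero_iff_dvd (4 * (4 * a z + a i + 2 * a j)) 8).2 (by omega)
    exact_mod_cast this
  rw [hand' _ heven] at h₃
  have h₁ := (ZMod.intCast_zmod_eq_zero_iff_dvd _ 8).1 h₁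
  have h₂ := (ZMod.intCast_eq_intCast_iff_dvd_sub _ (2 * (2 * a z + a j)) 4).1
    (h₂.trans (by push_cast; rfl))
  have h₃ := (ZMod.intCast_eq_intCast_iff_dvd_sub _ (2 * (4 * a z + a i + 2 * a j)) 8).1
    (h₃.trans (by push_cast; rfl))
  push_cast at h₁ h₂ h₃
  omega

theorem rowOrder_dvd_two_mul_of_carry_mem (hM : HasHadamardColumns t₁ t₂ M) (hr : t₁ + t₂ < r)
    (ht : 2 ≤ t₁ + t₂) {a : Fin r → ℤ}
    (ha : ∀ g ∈ M.additiveCode, carry (∑ k, a k • M.row k) g ∈ M.additiveCode) (k : Fin r) :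
    (rowOrder t₁ t₂ k : ℤ) ∣ 2 * a k := by
  have hex : ∃ j : Fin r, 1 ≤ (j : ℕ) ∧ (j : ℕ) ≤ t₁ + t₂ ∧ k ≠ j := by
    by_cases hk : (k : ℕ) = 1
    · exact ⟨⟨2, by omega⟩, by simp, ht, fun h => by simp [h] at hk⟩
    · exact ⟨⟨1, by omega⟩, le_rfl, by simp; omega, fun h => by simp [h] at hk⟩
  obtain ⟨j, hj, hjt, hkj⟩ := hex
  rcases rowOrder_cases t₁ t₂ k with ⟨-, ho⟩ | ⟨hk, ho⟩ | ⟨hk, ho⟩ <;> rw [ho]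
  · exact Dvd.intro _ rfl
  · have := hM.two_dvd_of_carry_mem ha hk.2.1 hk.2.2 hj hjt hkj
    push_cast
    omega
  · have := hM.four_dvd_of_carry_mem ha hk.1 hk.2 hj hjt hkj
    push_cast
    omega

/-- If only one row has order greater than 2, then every carry is an even multiple of this row, so
the binary code is linear. -/
theorem isLinearCode_of_add_eq_one (hM : HasHadamardColumns t₁ t₂ M) (hr : t₁ + t₂ < r)
    (ht : t₁ + t₂ = 1) : IsLinearCode M.binaryCode := by
  refine isLinearCode_of_carry_mem _ fun h hh g hg => ?_
  obtain ⟨i, h1⟩ : ∃ i : Fin r, (i : ℕ) = 1 := ⟨⟨1, by omega⟩, rfl⟩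
  obtain ⟨a, rfl⟩ := mem_additiveCode_iff.1 hh
  obtain ⟨b, rfl⟩ := mem_additiveCode_iff.1 hg
  -- All coordinates over `ℤ₄` are `a_i` modulo 2, and all those over `ℤ₈` are `a_i` modulo 4.
  have h4 : ∀ (a : Fin r → ℤ) p, 2 * ((∑ k, a k • M.row k).2.1 p - (a i : ZMod 4)) = 0 := by
    intro a p
    rw [sum_zsmul_row_apply₂, ← Finset.add_sum_erase _ _ (Finset.mem_univ i),
      hM.row_one₂ ht i p h1, mul_one, add_sub_cancel_left, Finset.mul_sum]
    refine Finset.sum_eq_zero fun k hk => ?_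
    have hki : (k : ℕ) ≠ 1 := fun h => (Finset.ne_of_mem_erase hk) (Fin.ext (by omega))
    rw [mul_left_comm]
    by_cases hk0 : (k : ℕ) = 0
    · rw [hM.row_zero₂ k p hk0]
      exact mul_eq_zero_of_right _ rfl
    · rw [hM.two_mul₂ k p (by omega), mul_zero]
  have h8 : ∀ (a : Fin r → ℤ) p, 2 * ((∑ k, a k • M.row k).2.2 p - (a i : ZMod 8)) = 0 := by
    intro a p
    rw [sum_zsmul_row_apply₃, ← Finset.add_sum_erase _ _ (Finset.mem_univ i),
      hM.row_one₃ ht i p h1, mul_one, add_sub_cancel_left, Finset.mul_sum]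
    refine Finset.sum_eq_zero fun k hk => ?_
    have hki : (k : ℕ) ≠ 1 := fun h => (Finset.ne_of_mem_erase hk) (Fin.ext (by omega))
    rw [mul_left_comm]
    by_cases hk0 : (k : ℕ) = 0
    · rw [hM.row_zero₃ k p hk0]
      exact mul_eq_zero_of_right _ rfl
    · rw [hM.two_mul₃ k p (by omega), mul_zero]
  have and4 : ∀ u v x y : ZMod 4, 2 * (u - x) = 0 → 2 * (v - y) = 0 →
      2 * ((u.val &&& v.val : ℕ) : ZMod 4) = 2 * ((x.val &&& y.val : ℕ) : ZMod 4) := by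
    decide +kernel
  have and8 : ∀ u v x y : ZMod 8, 2 * (u - x) = 0 → 2 * (v - y) = 0 →
      2 * ((u.val &&& v.val : ℕ) : ZMod 8) = 2 * ((x.val &&& y.val : ℕ) : ZMod 8) := by
    decide +kernel
  have and84 : ∀ x y : ZMod 8, 2 * (((ZMod.castHom (by norm_num : 4 ∣ 8) (ZMod 4) x).val &&&
      (ZMod.castHom (by norm_num : 4 ∣ 8) (ZMod 4) y).val : ℕ) : ZMod 4) =
        2 * ((x.val &&& y.val : ℕ) : ZMod 4) := by
    decide +kernel
  have hcarry : carry (∑ k, a k • M.row k) (∑ k, b k • M.row k) =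
      (2 * ((a i : ZMod 8).val &&& (b i : ZMod 8).val)) • M.row i := by
    refine Prod.ext (funext fun p => ?_) (Prod.ext (funext fun p => ?_) (funext fun p => ?_))
    · change 0 = (2 * _) • M.A₁ i p
      rw [mul_smul, two_nsmul, CharTwo.add_self_eq_zero]
    · change _ = (2 * _) • M.A₂ i p
      rw [hM.row_one₂ ht i p h1]
      have := and84 (a i) (b i)
      simp only [map_intCast] at this
      refine (and4 _ _ _ _ (h4 a p) (h4 b p)).trans ?_
      simp [nsmul_eq_mul, this]
    · change _ = (2 * _) • M.A₃ i p
      rw [hM.row_one₃ ht i p h1]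
      refine (and8 _ _ _ _ (h8 a p) (h8 b p)).trans ?_
      simp [nsmul_eq_mul]
  rw [hcarry]
  exact AddSubgroup.nsmul_mem _ (row_mem_additiveCode M i) _

/-! ### The basis of the kernel -/

theorem exists_basis_codeKernel (hM : HasHadamardColumns t₁ t₂ M) (hr : t₁ + t₂ < r)
    (ht : 2 ≤ t₁ + t₂) :
    ∃ b : Module.Basis (Fin r) (ZMod 2) (codeKernel M.binaryCode), ∀ k,
      (b k : GrayIndex _ _ _ → ZMod 2) = grayMap ((addOrderOf (M.row k) / 2) • M.row k) := by
  simp only [hM.addOrderOf_row hr]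
  have htwo : ∀ k : Fin r, 2 • ((rowOrder t₁ t₂ k / 2) • M.row k) = 0 := fun k => by
    rw [smul_smul, two_mul_rowOrder_div_two, hM.rowOrder_nsmul_row]
  have hmem : ∀ k : Fin r,
      grayMap ((rowOrder t₁ t₂ k / 2) • M.row k) ∈ codeKernel M.binaryCode := fun k =>
    (mem_codeKernel_grayMap_iff _ _).2
      ⟨_, AddSubgroup.nsmul_mem _ (row_mem_additiveCode M k) _, rfl, fun g _ => by
        rw [carry_eq_zero (htwo k)]
        exact AddSubgroup.zero_mem _⟩
  let v : Fin r → codeKernel M.binaryCode := fun k => ⟨_, hmem k⟩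
  have hv : ∀ c : Fin r → ZMod 2, ((∑ k, c k • v k : codeKernel M.binaryCode) :
      GrayIndex M.ι₁ M.ι₂ M.ι₃ → ZMod 2) =
        grayMap (∑ k, (((c k).val * (rowOrder t₁ t₂ k / 2) : ℕ) : ℤ) • M.row k) := by
    intro c
    simp only [natCast_zsmul, mul_smul]
    rw [grayMap_sum_val_nsmul _ _ htwo]
    simp [v]
  have hli : LinearIndependent (ZMod 2) v := by
    refine Fintype.linearIndependent_iff.2 fun c hc k => ?_
    have h0 := (hv c).symm.trans (congrArg Subtype.val hc)
    have h0 := grayMap_injective (h0.trans grayMap_zero.symm)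
    have h := (hM.sum_zsmul_row_eq_zero_iff hr _).1 h0 k
    have hlt := (c k).val_lt
    rw [← ZMod.val_eq_zero]
    norm_cast at h
    rcases rowOrder_cases t₁ t₂ k with ⟨-, ho⟩ | ⟨-, ho⟩ | ⟨-, ho⟩ <;> rw [ho] at h <;> omega
  have hspan : ⊤ ≤ Submodule.span (ZMod 2) (Set.range v) := by
    rintro ⟨x, hx⟩ -
    obtain ⟨h, hh, rfl, hc⟩ := (mem_codeKernel_grayMap_iff _ _).1 hx
    obtain ⟨a, rfl⟩ := mem_additiveCode_iff.1 hh
    have hdvd := hM.rowOrder_dvd_two_mul_of_carry_mem hr ht hc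
    -- The coefficient `a_k` is a multiple of half the order of `w_k`; only its parity matters.
    refine (Submodule.mem_span_range_iff_exists_fun _).2
      ⟨fun k => ((a k / (rowOrder t₁ t₂ k / 2 : ℕ) : ℤ) : ZMod 2), Subtype.ext ?_⟩
    rw [hv]
    refine congrArg grayMap (sub_eq_zero.1 ?_)
    rw [← Finset.sum_sub_distrib]
    simp only [← sub_smul]
    refine (hM.sum_zsmul_row_eq_zero_iff hr _).2 fun k => ?_
    have hval : ((((a k / (rowOrder t₁ t₂ k / 2 : ℕ) : ℤ) : ZMod 2).val : ℕ) : ℤ) =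
        (a k / (rowOrder t₁ t₂ k / 2 : ℕ)) % 2 := ZMod.val_intCast _
    have hk := hdvd k
    rw [Nat.cast_mul, hval]
    rcases rowOrder_cases t₁ t₂ k with ⟨-, ho⟩ | ⟨-, ho⟩ | ⟨-, ho⟩ <;> rw [ho] at hk ⊢ <;>
      norm_num at hk ⊢ <;> omega
  exact ⟨Module.Basis.mk hli hspan, fun k => by rw [Module.Basis.mk_apply]⟩

end HasHadamardColumns

end Z2Z4Z8

theorem mainTheorem2 (t₁ t₂ t₃ : ℕ) (h₁ : 1 ≤ t₁) (h₃ : 1 ≤ t₃)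
    (hnonlinear : ¬ Z2Z4Z8.IsLinearCode (Z2Z4Z8.matrixA t₁ t₂ t₃ h₁ h₃).binaryCode) :
    (∃ b : Module.Basis (Fin (t₁ + t₂ + t₃)) (ZMod 2)
        (Z2Z4Z8.codeKernel (Z2Z4Z8.matrixA t₁ t₂ t₃ h₁ h₃).binaryCode),
      ∀ k : Fin (t₁ + t₂ + t₃),
        (b k : Z2Z4Z8.GrayIndex _ _ _ → ZMod 2) =
          Z2Z4Z8.grayMap
            ((addOrderOf ((Z2Z4Z8.matrixA t₁ t₂ t₃ h₁ h₃).row k) / 2) •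
              (Z2Z4Z8.matrixA t₁ t₂ t₃ h₁ h₃).row k)) ∧
      Z2Z4Z8.kerDim (Z2Z4Z8.matrixA t₁ t₂ t₃ h₁ h₃).binaryCode = t₁ + t₂ + t₃ := by
  have hM := Z2Z4Z8.hasHadamardColumns_matrixA t₁ t₂ t₃ h₁ h₃
  have hr : t₁ + t₂ < t₁ + t₂ + t₃ := by omega
  have ht : 2 ≤ t₁ + t₂ := by
    by_contra h
    exact hnonlinear (hM.isLinearCode_of_add_eq_one hr (by omega))
  obtain ⟨b, hb⟩ := hM.exists_basis_codeKernel hr ht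
  exact ⟨⟨b, hb⟩, by rw [Z2Z4Z8.kerDim, Module.finrank_eq_card_basis b, Fintype.card_fin]⟩
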